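/- A topological dynamical system (t.d.s.) is a pair $(X,T)$ with $X$ a compact metric space and $T:X\to X$ continuous and surjective. It is transitive if for all nonempty open $U,V\subset X$ the set $\{n\ge 0: U\cap T^{-n}V\neq\emptyset\}$ is infinite, and weakly mixing if $(X\times X,T\times T)$ is transitive. It is minimal if $X\neq\emptyset$ and every forward orbit $\{T^nx:n\ge 0\}$ is dense in $X$; a point $x\in X$ is minimal if its forward orbit closure is a minimal subsystem. A joining of $(X,T)$ and $(Y,S)$ is a nonempty closed set $J\subset X\times Y$ with $(T\times S)(J)\subset J$ which the coordinate projections map onto $X$ and onto $Y$; the two systems are disjoint if $X\times Y$ is their only joining. A set $A\subset\{0,1,2,\dots\}$ is syndetic if there is $N$ such that $\{i,i+1,\dots,i+N\}\cap A\neq\emptyset$ for every $i\ge 0$. For $U\subset X$, $V\subset Y$ put $N_{T\times S}((x,y),U\times V)=\{n\ge 0: T^nx\in U,\ S^ny\in V\}$. **Theorem 3.1.** Let $(X,T)$ be a transitive t.d.s. Then the following statements are equivalent. 1. $(X,T)$ is disjoint from all minimal systems. 2. $(X,T)$ is weakly mixing and there is a countable dense subset $D$ of $X$ such that for any minimal system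 $(Y,S)$, any point $y\in Y$, any open neighbourhood $V$ of $y$ and any nonempty open subset $U\subset X$, there is $x\in D\cap U$ such that $N_{T\times S}((x,y),U\times V)$ is syndetic. 3. $(X,T)$ is weakly mixing and there is a countable dense subset $D$ of $X$ consisting of minimal points such that for any minimal system $(Y,S)$, any point $y\in Y$, any open neighbourhood $V$ of $y$ and any nonempty open subset $U\subset X$, there is $x\in D\cap U$ such that $N_{T\times S}((x,y),U\times V)$ is syndetic. -/

import Mathlib

universe u

namespace TopDyn

/-- `(X, T)` is a topological dynamical system: `T` is a continuous surjective self-map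
(the phase space is required to be compact metric wherever this is used). -/
structure IsTDS {X : Type*} [TopologicalSpace X] (T : X → X) : Prop where
  continuous : Continuous T
  surjective : Function.Surjective T

/-- The forward orbit `{T ^ n x : n ≥ 0}`. -/
def orbit {X : Type*} (T : X → X) (x : X) : Set X :=
  Set.range fun n : ℕ => T^[n] x

/-- `N_T(x, U) = {n ≥ 0 : T ^ n x ∈ U}`. -/
def hitTimes {X : Type*} (T : X → X) (x : X) (U : Set X) : Set ℕ :=
  {n | T^[n] x ∈ U}

/-- `N_T(U, V) = {n ≥ 0 : U ∩ T ^ (-n) V ≠ ∅}`. -/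
def setHitTimes {X : Type*} (T : X → X) (U V : Set X) : Set ℕ :=
  {n | (U ∩ T^[n] ⁻¹' V).Nonempty}

/-- Topological transitivity: `N_T(U, V)` is infinite for all nonempty open `U`, `V`. -/
def IsTransitive {X : Type*} [TopologicalSpace X] (T : X → X) : Prop :=
  ∀ U V : Set X, IsOpen U → U.Nonempty → IsOpen V → V.Nonempty → (setHitTimes T U V).Infinite

/-- Weak mixing: `T × T` is transitive on `X × X`. -/
def IsWeaklyMixing {X : Type*} [TopologicalSpace X] (T : X → X) : Prop :=
  IsTransitive (Prod.map T T)

/-- A minimal system: a nonempty system in which every point has a dense forward orbit. -/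
structure IsMinimalSystem {Y : Type*} [TopologicalSpace Y] (S : Y → Y) : Prop where
  isTDS : IsTDS S
  nonempty : Nonempty Y
  dense_orbit : ∀ y : Y, Dense (orbit S y)

/-- A minimal point: the forward orbit closure of `x` is a minimal subsystem, that is, each of
its points has a forward orbit that is dense in it. -/
def IsMinimalPoint {X : Type*} [TopologicalSpace X] (T : X → X) (x : X) : Prop :=
  ∀ z ∈ closure (orbit T x), closure (orbit T z) = closure (orbit T x)

/-- A joining: a nonempty closed invariant subset of `X × Y` with full projections. -/
structure IsJoining {X Y : Type*} [TopologicalSpace X] [TopologicalSpace Y]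
    (T : X → X) (S : Y → Y) (J : Set (X × Y)) : Prop where
  nonempty : J.Nonempty
  isClosed : IsClosed J
  invariant : Set.MapsTo (Prod.map T S) J J
  fst_image : Prod.fst '' J = Set.univ
  snd_image : Prod.snd '' J = Set.univ

/-- Disjointness: the full product is the only joining. -/
def AreDisjoint {X Y : Type*} [TopologicalSpace X] [TopologicalSpace Y]
    (T : X → X) (S : Y → Y) : Prop :=
  ∀ J : Set (X × Y), IsJoining T S J → J = Set.univ

/-- Disjointness from all minimal systems on compact metric spaces. -/
def DisjointFromAllMinimal {X : Type u} [TopologicalSpace X] (T : X → X) : Prop :=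
  ∀ (Y : Type u) [MetricSpace Y] [CompactSpace Y] (S : Y → Y),
    IsMinimalSystem S → AreDisjoint T S

/-- A syndetic set of nonnegative integers: one with bounded gaps. -/
def IsSyndetic (A : Set ℕ) : Prop :=
  ∃ N : ℕ, ∀ i : ℕ, (Set.Icc i (i + N) ∩ A).Nonempty

/-- For every minimal system `(Y, S)`, every `y ∈ Y` with open neighbourhood `V` and every nonempty
open `U ⊆ X`, some `x ∈ D ∩ U` has `N_{T × S}((x, y), U × V)` syndetic. -/
def HasSyndeticTransfer {X : Type u} [TopologicalSpace X] (T : X → X) (D : Set X) : Prop :=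
  ∀ (Y : Type u) [MetricSpace Y] [CompactSpace Y] (S : Y → Y), IsMinimalSystem S →
    ∀ (y : Y) (V : Set Y), IsOpen V → y ∈ V →
      ∀ U : Set X, IsOpen U → U.Nonempty →
        ∃ x ∈ D ∩ U, IsSyndetic (hitTimes (Prod.map T S) (x, y) (U ×ˢ V))

end TopDyn

/-! From 2 to 1: weak mixing and Baire category give one point x such that, for every m and every d
in D, T^m x shadows d along arbitrarily long intervals of times. Such an interval meets the syndetic
set of times at which (d, S^m y) visits a given box, so any pair (x, y) lying in a joining has a
dense orbit and the joining is everything.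

From 1 to 3: the orbit closure of a transitive point paired with a point of a minimal system is a
joining, hence the whole product. Three consequences follow. Minimal points are dense: if an open
set had none, all orbits would make long stays, with bounded gaps, outside a closed C with interior
in that set. The stays leave room for a nonzero minimal 0-1 sequence whose ones avoid the visits of
a transitive point to C (`exists_isMinimalPoint_shift`), contradicting density of the paired orbit.
Weak mixing: pair a transitive point with a minimal one. Syndetic transfer: by compactness finitely
many visits of a transitive point to U serve all of Y; a nearby minimal point copies these visits
and recurs syndetically. -/

namespace TopDyn

open Set Filter Topology

/-! ### Minimal points and transitive points. -/

section Basic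

variable {X : Type*} [TopologicalSpace X] {T : X → X}

lemma self_mem_closure_orbit (T : X → X) (x : X) : x ∈ closure (orbit T x) :=
  subset_closure ⟨0, rfl⟩

lemma iterate_mem_closure_orbit (T : X → X) (x : X) (n : ℕ) :
    T^[n] x ∈ closure (orbit T x) :=
  subset_closure ⟨n, rfl⟩

lemma closure_orbit_subset {K : Set X} (hK : IsClosed K) (hTK : MapsTo T K K) {x : X}
    (hx : x ∈ K) : closure (orbit T x) ⊆ K := by
  refine closure_minimal ?_ hK
  rintro _ ⟨n, rfl⟩
  exact hTK.iterate n hx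

lemma mapsTo_closure_orbit (hT : Continuous T) (x : X) :
    MapsTo T (closure (orbit T x)) (closure (orbit T x)) := by
  refine MapsTo.closure ?_ hT
  rintro _ ⟨n, rfl⟩
  exact ⟨n + 1, Function.iterate_succ_apply' T n x⟩

lemma closure_orbit_subset_of_mem (hT : Continuous T) {x z : X}
    (hz : z ∈ closure (orbit T x)) : closure (orbit T z) ⊆ closure (orbit T x) :=
  closure_orbit_subset isClosed_closure (mapsTo_closure_orbit hT x) hz

/-- Every orbit closure in a compact system contains a minimal point. -/
lemma exists_isMinimalPoint_mem_closure_orbit [CompactSpace X] (hT : Continuous T) (x : X) :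
    ∃ z ∈ closure (orbit T x), IsMinimalPoint T z := by
  obtain ⟨M, hMx, hM⟩ := zorn_superset_nonempty
    {K : Set X | K.Nonempty ∧ IsClosed K ∧ MapsTo T K K} (by
      intro c hc hchain hne
      refine ⟨⋂₀ c, ⟨?_, isClosed_sInter fun K hK => (hc hK).2.1, ?_⟩,
        fun s hs => sInter_subset_of_mem hs⟩
      · have : Nonempty c := hne.to_subtype
        rw [sInter_eq_iInter]
        refine IsCompact.nonempty_iInter_of_directed_nonempty_isCompact_isClosed _ ?_
          (fun K => (hc K.2).1) (fun K => (hc K.2).2.1.isCompact) (fun K => (hc K.2).2.1)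
        intro a b
        rcases hchain.total a.2 b.2 with h | h
        · exact ⟨a, subset_rfl, h⟩
        · exact ⟨b, h, subset_rfl⟩
      · intro y hy K hK
        exact (hc hK).2.2 (hy K hK))
    (closure (orbit T x))
    ⟨⟨x, self_mem_closure_orbit T x⟩, isClosed_closure, mapsTo_closure_orbit hT x⟩
  have key : ∀ z ∈ M, closure (orbit T z) = M := fun z hz =>
    (closure_orbit_subset hM.prop.2.1 hM.prop.2.2 hz).antisymm
      (hM.le_of_le ⟨⟨z, self_mem_closure_orbit T z⟩, isClosed_closure, mapsTo_closure_orbit hT z⟩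
        (closure_orbit_subset hM.prop.2.1 hM.prop.2.2 hz))
  obtain ⟨z, hz⟩ := hM.prop.1
  refine ⟨z, hMx hz, fun w hw => ?_⟩
  rw [key z hz] at hw ⊢
  exact key w hw

/-- A minimal point returns syndetically to each of its neighbourhoods. -/
lemma IsMinimalPoint.isSyndetic_hitTimes [CompactSpace X] (hT : Continuous T) {x : X}
    (hx : IsMinimalPoint T x) {W : Set X} (hW : IsOpen W) (hxW : x ∈ W) :
    IsSyndetic (hitTimes T x W) := by
  obtain ⟨t, ht⟩ := (isClosed_closure (s := orbit T x)).isCompact.elim_finite_subcover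
    (fun n : ℕ => T^[n] ⁻¹' W) (fun n => hW.preimage (hT.iterate n)) (by
      intro z hz
      have hxz : x ∈ closure (orbit T z) := by
        rw [hx z hz]
        exact self_mem_closure_orbit T x
      obtain ⟨_, hw, n, rfl⟩ := mem_closure_iff.1 hxz W hW hxW
      exact mem_iUnion.2 ⟨n, hw⟩)
  refine ⟨t.sup id, fun i => ?_⟩
  obtain ⟨n, hn, hnW⟩ := mem_iUnion₂.1 (ht (iterate_mem_closure_orbit T x i))
  have hle : n ≤ t.sup id := Finset.le_sup (f := id) hn
  refine ⟨n + i, ⟨by omega, by omega⟩, ?_⟩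
  rw [mem_preimage, ← Function.iterate_add_apply] at hnW
  exact hnW

/-- Uniformly recurrent points are minimal. -/
lemma isMinimalPoint_of_isSyndetic [RegularSpace X] (hT : Continuous T) {x : X}
    (h : ∀ W : Set X, IsOpen W → x ∈ W → IsSyndetic (hitTimes T x W)) : IsMinimalPoint T x := by
  intro z hz
  refine (closure_orbit_subset_of_mem hT hz).antisymm (closure_orbit_subset_of_mem hT ?_)
  refine mem_closure_iff.2 fun W hW hxW => ?_
  -- Bounded gaps put the orbit in finitely many preimages of `C`; as `C` is closed, the orbit
  -- closure, and so `z`, lies there too.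
  obtain ⟨C, hC, hCc, hCW⟩ := exists_mem_nhds_isClosed_subset (hW.mem_nhds hxW)
  obtain ⟨N, hN⟩ := h (interior C) isOpen_interior (mem_interior_iff_mem_nhds.2 hC)
  have hcl : IsClosed (⋃ n ∈ Finset.range (N + 1), T^[n] ⁻¹' C) :=
    isClosed_biUnion_finset fun n _ => hCc.preimage (hT.iterate n)
  have hsub : closure (orbit T x) ⊆ ⋃ n ∈ Finset.range (N + 1), T^[n] ⁻¹' C := by
    refine closure_minimal ?_ hcl
    rintro _ ⟨i, rfl⟩
    obtain ⟨n, ⟨hin, hni⟩, hn⟩ := hN i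
    refine mem_iUnion₂.2 ⟨n - i, Finset.mem_range.2 (by omega), ?_⟩
    rw [mem_preimage, ← Function.iterate_add_apply, Nat.sub_add_cancel hin]
    exact interior_subset hn
  obtain ⟨n, -, hn⟩ := mem_iUnion₂.1 (hsub hz)
  exact ⟨_, hCW hn, n, rfl⟩

/-- The orbit closure of a minimal point is a minimal system. -/
lemma IsMinimalPoint.isMinimalSystem_restrict [CompactSpace X] [T2Space X] (hT : Continuous T)
    {x : X} (hx : IsMinimalPoint T x) :
    IsMinimalSystem ((mapsTo_closure_orbit hT x).restrict) := by
  set K := closure (orbit T x) with hK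
  set S : K → K := (mapsTo_closure_orbit hT x).restrict with hS
  have hSc : Continuous S := hT.restrict _
  have hiter : ∀ (n : ℕ) (z : K), ((S^[n] z : K) : X) = T^[n] z := by
    intro n z
    induction n generalizing z with
    | zero => rfl
    | succ n ih => rw [Function.iterate_succ_apply, ih, Function.iterate_succ_apply]; rfl
  have hdense : ∀ z : K, Dense (orbit S z) := by
    intro z w
    rw [closure_subtype]
    have himg : ((↑) : K → X) '' orbit S z = orbit T z := by
      ext a
      constructor
      · rintro ⟨_, ⟨n, rfl⟩, rfl⟩
        exact ⟨n, (hiter n z).symm⟩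
      · rintro ⟨n, rfl⟩
        exact ⟨_, ⟨n, rfl⟩, hiter n z⟩
    rw [himg, hx z z.2]
    exact w.2
  have : CompactSpace K := isCompact_iff_compactSpace.1 isClosed_closure.isCompact
  refine ⟨⟨hSc, ?_⟩, ⟨⟨x, self_mem_closure_orbit T x⟩⟩, hdense⟩
  rw [← range_eq_univ, eq_univ_iff_forall]
  intro w
  have hcl : IsClosed (range S) := (isCompact_range hSc).isClosed
  -- The range is closed and invariant and contains `S w`, whose orbit is dense.
  refine closure_orbit_subset hcl (fun y _ => mem_range_self y) (mem_range_self w) ?_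
  exact hdense (S w) w

/-- A point visiting every nonempty open set infinitely often. -/
def IsTransitivePoint (T : X → X) (x : X) : Prop :=
  ∀ V : Set X, IsOpen V → V.Nonempty → ∃ᶠ n in atTop, T^[n] x ∈ V

lemma IsTransitivePoint.dense_orbit {x : X} (hx : IsTransitivePoint T x) (m : ℕ) :
    Dense (orbit T (T^[m] x)) := by
  rw [dense_iff_inter_open]
  intro V hV hne
  obtain ⟨n, hmn, hn⟩ := frequently_atTop.1 (hx V hV hne) m
  refine ⟨_, hn, n - m, ?_⟩
  simp only [← Function.iterate_add_apply, Nat.sub_add_cancel hmn]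

/-- The transitive points of a transitive system are dense. -/
lemma IsTransitive.dense_isTransitivePoint [BaireSpace X] [SecondCountableTopology X]
    (hT : Continuous T) (h : IsTransitive T) : Dense {x | IsTransitivePoint T x} := by
  obtain ⟨b, hbc, hb0, hb⟩ := TopologicalSpace.exists_countable_basis X
  have : Countable b := hbc.to_subtype
  have hd : Dense (⋂ p : b × ℕ, ⋃ n ≥ p.2, T^[n] ⁻¹' (p.1 : Set X)) := by
    refine dense_iInter_of_isOpen (fun p => ?_) (fun p => ?_)
    · exact isOpen_biUnion fun n _ => (hb.isOpen p.1.2).preimage (hT.iterate n)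
    · rw [dense_iff_inter_open]
      intro U hU hne
      have hVne : (p.1 : Set X).Nonempty :=
        nonempty_iff_ne_empty.2 fun h0 => hb0 (h0 ▸ p.1.2)
      obtain ⟨n, ⟨x, hxU, hxV⟩, hn⟩ :=
        (h U p.1 hU hne (hb.isOpen p.1.2) hVne).exists_gt p.2
      exact ⟨x, hxU, mem_iUnion₂.2 ⟨n, hn.le, hxV⟩⟩
  refine hd.mono fun x hx V hV hne => frequently_atTop.2 fun m => ?_
  obtain ⟨y, hy⟩ := hne
  obtain ⟨B, hB, -, hBV⟩ := hb.exists_subset_of_mem_open hy hV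
  obtain ⟨n, hn, hnB⟩ := mem_iUnion₂.1 (mem_iInter.1 hx (⟨B, hB⟩, m))
  exact ⟨n, hn, hBV hnB⟩

end Basic

lemma iterate_prodMap {X Y : Type*} (T : X → X) (S : Y → Y) (n : ℕ) (p : X × Y) :
    (Prod.map T S)^[n] p = (T^[n] p.1, S^[n] p.2) := by
  rw [Prod.map_iterate]; rfl

/-! ### Density of product orbits under disjointness. -/

section Disjoint

variable {X : Type u} [TopologicalSpace X] [CompactSpace X] [T2Space X] {T : X → X}

/-- If `x` has a dense orbit and the two systems are disjoint, then every orbit of a point over `x`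
is dense. -/
lemma AreDisjoint.dense_orbit_prod {Y : Type*} [TopologicalSpace Y] [CompactSpace Y] [T2Space Y]
    {S : Y → Y} (h : AreDisjoint T S) (hT : Continuous T) (hS : Continuous S) {x : X} {y : Y}
    (hx : Dense (orbit T x)) (hy : Dense (orbit S y)) :
    Dense (orbit (Prod.map T S) (x, y)) := by
  rw [dense_iff_closure_eq]
  have hc : IsCompact (closure (orbit (Prod.map T S) (x, y))) := isClosed_closure.isCompact
  refine h _ ⟨⟨_, self_mem_closure_orbit _ _⟩, isClosed_closure,
    mapsTo_closure_orbit (hT.prodMap hS) _, ?_, ?_⟩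
  · rw [eq_univ_iff_forall]
    refine fun a => closure_minimal ?_ (hc.image continuous_fst).isClosed (hx a)
    rintro _ ⟨n, rfl⟩
    exact ⟨_, iterate_mem_closure_orbit _ _ n, by rw [iterate_prodMap]⟩
  · rw [eq_univ_iff_forall]
    refine fun a => closure_minimal ?_ (hc.image continuous_snd).isClosed (hy a)
    rintro _ ⟨n, rfl⟩
    exact ⟨_, iterate_mem_closure_orbit _ _ n, by rw [iterate_prodMap]⟩

lemma DisjointFromAllMinimal.exists_iterate_mem (h : DisjointFromAllMinimal T) (hT : Continuous T)
    {Y : Type u} [MetricSpace Y] [CompactSpace Y] {S : Y → Y} (hS : IsMinimalSystem S)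
    {x : X} (hx : IsTransitivePoint T x) (y : Y) {U : Set X} {V : Set Y} (hU : IsOpen U)
    (hUne : U.Nonempty) (hV : IsOpen V) (hVne : V.Nonempty) (m : ℕ) :
    ∃ n ≥ m, T^[n] x ∈ U ∧ S^[n] y ∈ V := by
  have hd := (h Y S hS).dense_orbit_prod hT hS.isTDS.continuous (hx.dense_orbit m)
    (hS.dense_orbit (S^[m] y))
  obtain ⟨_, hw, n, rfl⟩ := hd.inter_open_nonempty (U ×ˢ V) (hU.prod hV) (hUne.prod hVne)
  refine ⟨n + m, Nat.le_add_left _ _, ?_⟩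
  simpa only [iterate_prodMap, mem_prod, ← Function.iterate_add_apply] using hw

/-- Disjointness is applied to the orbit closure of `p`; the time `k` guarantees that `V` meets it.
-/
lemma DisjointFromAllMinimal.exists_iterate_mem_of_isMinimalPoint (h : DisjointFromAllMinimal T)
    (hT : Continuous T) {Z : Type u} [TopologicalSpace Z] [CompactSpace Z]
    [TopologicalSpace.MetrizableSpace Z] {R : Z → Z} (hR : Continuous R)
    {x : X} (hx : IsTransitivePoint T x) {p : Z} (hp : IsMinimalPoint R p) {U : Set X} {V : Set Z}
    (hU : IsOpen U) (hUne : U.Nonempty) (hV : IsOpen V) {k : ℕ} (hk : R^[k] p ∈ V) (m : ℕ) :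
    ∃ n ≥ m, T^[n] x ∈ U ∧ R^[n] p ∈ V := by
  let _ : MetricSpace Z := TopologicalSpace.metrizableSpaceMetric Z
  have : CompactSpace (closure (orbit R p)) :=
    isCompact_iff_compactSpace.1 isClosed_closure.isCompact
  obtain ⟨n, hn, hnU, hnV⟩ := h.exists_iterate_mem hT (hp.isMinimalSystem_restrict hR) hx
    ⟨p, self_mem_closure_orbit R p⟩ hU hUne (hV.preimage continuous_subtype_val)
    ⟨⟨_, iterate_mem_closure_orbit R p k⟩, hk⟩ m
  refine ⟨n, hn, hnU, ?_⟩
  rw [MapsTo.iterate_restrict] at hnV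
  exact hnV

end Disjoint

/-! ### Construction of a minimal 0-1 sequence from nested word sets. -/

section Words

open scoped Computability

variable {X : Type*} {T : X → X} {U : Set X}

/-- The letter `1` of the two-letter alphabet. -/
abbrev mark : ULift.{u} Bool := ⟨true⟩

/-- Placed at time `0`, the word `w` has its marks only at times at which `x` is outside `U`. -/
def Avoids (T : X → X) (U : Set X) (w : List (ULift.{u} Bool)) (x : X) : Prop :=
  ∀ i, w[i]? = some mark → T^[i] x ∉ U

lemma Avoids.append {v w : List (ULift.{u} Bool)} {x : X} (hv : Avoids T U v x)
    (hw : Avoids T U w (T^[v.length] x)) : Avoids T U (v ++ w) x := by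
  intro i hi
  rcases lt_or_ge i v.length with h | h
  · rw [List.getElem?_append_left h] at hi
    exact hv i hi
  · rw [List.getElem?_append_right h] at hi
    have := hw _ hi
    rwa [← Function.iterate_add_apply, Nat.sub_add_cancel h] at this

/-- A finite set of nonempty words, one of which fits at each point. -/
structure IsAdapted (T : X → X) (U : Set X) (W : Language (ULift.{u} Bool)) : Prop where
  nonempty : ∃ w, w ∈ W
  finite : {w | w ∈ W}.Finite
  ne_nil : ∀ w ∈ W, w ≠ []
  exists_avoids : ∀ x, ∃ w ∈ W, Avoids T U w x

lemma exists_length_le {W : Language (ULift.{u} Bool)}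
    (h : {w | w ∈ W}.Finite) : ∃ m, ∀ w ∈ W, w.length ≤ m := by
  obtain ⟨m, hm⟩ := (h.image List.length).bddAbove
  exact ⟨m, fun w hw => hm (mem_image_of_mem _ hw)⟩

lemma append_mem_kstar {α : Type*} {W : Language α} {v w : List α} (hv : v ∈ W∗) (hw : w ∈ W∗) :
    v ++ w ∈ W∗ := by
  rw [← kstar_mul_kstar]
  exact Language.append_mem_mul hv hw

lemma mem_kstar_of_mem {α : Type*} {W : Language α} {w : List α} (hw : w ∈ W) : w ∈ W∗ :=
  (le_kstar : W ≤ W∗) hw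

/-- Greedy concatenation of fitting words, followed during a long stay outside `U`. -/
lemma IsAdapted.exists_kstar_avoids {W : Language (ULift.{u} Bool)} (h : IsAdapted T U W) {m : ℕ}
    (hm : ∀ w ∈ W, w.length ≤ m) (x : X) (s : ℕ) :
    ∃ v ∈ W∗, Avoids T U v x ∧ s ≤ v.length ∧ v.length ≤ s + m := by
  induction s with
  | zero => exact ⟨[], Language.nil_mem_kstar W, by intro i hi; simp at hi, by simp, by simp⟩
  | succ s ih =>
    obtain ⟨v, hvW, hv, hsv, hvs⟩ := ih
    rcases lt_or_ge s v.length with h1 | h1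
    · exact ⟨v, hvW, hv, h1, by omega⟩
    · obtain ⟨w, hwW, hw⟩ := h.exists_avoids (T^[v.length] x)
      have := List.length_pos_of_ne_nil (h.ne_nil w hwW)
      have := hm w hwW
      exact ⟨v ++ w, append_mem_kstar hvW (mem_kstar_of_mem hwW), hv.append hw,
        by rw [List.length_append]; omega, by rw [List.length_append]; omega⟩

/-- If long stays outside `U` occur with bounded gaps, an adapted set of words can be refined to one
all of whose words contain all the original words. -/
lemma IsAdapted.exists_refinement
    (hrun : ∀ L : ℕ, ∃ g : ℕ, ∀ x : X, ∃ s ≤ g, ∀ j < L, T^[s + j] x ∉ U)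
    {W : Language (ULift.{u} Bool)} (h : IsAdapted T U W) :
    ∃ W' : Language (ULift.{u} Bool), IsAdapted T U W' ∧ W' ≤ W∗ ∧
      ∀ w' ∈ W', ∀ w ∈ W, w <:+: w' ∧ w.length < w'.length := by
  obtain ⟨m, hm⟩ := exists_length_le h.finite
  set l := h.finite.toFinset.toList with hl
  have hmem : ∀ w, w ∈ l ↔ w ∈ W := fun w => by
    rw [hl, Finset.mem_toList, Set.Finite.mem_toFinset, mem_ofPred_eq]
  -- Doubling makes `u` strictly longer than each word of `W`, even if `W` has only one.
  set u := l.flatten ++ l.flatten with hu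
  have huW : u ∈ W∗ := by
    have : l.flatten ∈ W∗ := Language.mem_kstar.2 ⟨l, rfl, fun w hw => (hmem w).1 hw⟩
    exact append_mem_kstar this this
  have hinf : ∀ w ∈ W, w <:+: u ∧ w.length < u.length := by
    intro w hw
    have h1 : w <:+: l.flatten := by
      obtain ⟨a, b, hab⟩ := List.append_of_mem ((hmem w).2 hw)
      exact ⟨a.flatten, b.flatten, by rw [hab]; simp⟩
    have h2 := h1.length_le
    have h3 := List.length_pos_of_ne_nil (h.ne_nil w hw)
    refine ⟨h1.trans (List.prefix_append _ _).isInfix, ?_⟩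
    rw [hu, List.length_append]
    omega
  -- The filler `v` overshoots the start of the stay by at most `m`; the remaining `u.length` steps
  -- lie outside `U`, so `u` fits whatever its marks.
  obtain ⟨g, hg⟩ := hrun (m + u.length)
  refine ⟨{w | ∃ v ∈ W∗, v.length ≤ g + m ∧ w = v ++ u},
    ⟨⟨_, [], Language.nil_mem_kstar W, by simp, rfl⟩, ?_, ?_, ?_⟩, ?_, ?_⟩
  · refine (List.finite_length_le (ULift.{u} Bool) (g + m + u.length)).subset ?_
    rintro _ ⟨v, -, hv, rfl⟩
    simp only [mem_ofPred_eq, List.length_append]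
    omega
  · rintro _ ⟨v, -, -, rfl⟩ h0
    obtain ⟨-, h0⟩ := List.append_eq_nil_iff.1 h0
    obtain ⟨w, hw⟩ := h.nonempty
    have := (hinf w hw).2
    simp [h0] at this
  · intro x
    obtain ⟨s, hsg, hs⟩ := hg x
    obtain ⟨v, hvW, hv, hsv, hvs⟩ := h.exists_kstar_avoids hm x s
    refine ⟨v ++ u, ⟨v, hvW, by omega, rfl⟩, hv.append fun i hi => ?_⟩
    obtain ⟨hi, -⟩ := List.getElem?_eq_some_iff.1 hi
    have := hs (v.length - s + i) (by omega)
    rw [← Function.iterate_add_apply]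
    rwa [show s + (v.length - s + i) = i + v.length by omega] at this
  · rintro _ ⟨v, hv, -, rfl⟩
    exact append_mem_kstar hv huW
  · rintro _ ⟨v, -, -, rfl⟩ w hw
    obtain ⟨h1, h2⟩ := hinf w hw
    exact ⟨h1.trans (List.suffix_append _ _).isInfix, by rw [List.length_append]; omega⟩

/-- In a concatenation of words which all contain `v`, the word `v` occurs with bounded gaps. -/
lemma exists_occurrence {α : Type*} {W : Language α} {m : ℕ} (hm : ∀ w ∈ W, w.length ≤ m)
    {v : List α} (hv : ∀ w ∈ W, v <:+: w) {w : List α} (hw : w ∈ W∗) (i : ℕ)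
    (hi : i + 2 * m ≤ w.length) (hm0 : 0 < m) :
    ∃ s t, w = s ++ v ++ t ∧ i ≤ s.length ∧ s.length ≤ i + 2 * m := by
  obtain ⟨L, rfl, hL⟩ := Language.mem_kstar.1 hw
  clear hw
  induction L generalizing i with
  | nil => simp at hi; omega
  | cons a L ih =>
    have ha := hm a (hL a (by simp))
    rw [List.flatten_cons, List.length_append] at hi
    rcases le_or_gt a.length i with h | h
    · obtain ⟨s, t, hst, h1, h2⟩ := ih (i - a.length)
        (fun y hy => hL y (List.mem_cons_of_mem _ hy)) (by omega)
      refine ⟨a ++ s, t, by rw [List.flatten_cons, hst]; simp, ?_, ?_⟩ <;>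
        rw [List.length_append] <;> omega
    -- Position `i` falls inside `a`, so the copy of `v` is taken in the next word; there is one
    -- because `a.length ≤ m < 2 * m`.
    · cases L with
      | nil => simp at hi; omega
      | cons b L =>
        obtain ⟨s, t, hst⟩ := hv b (hL b (by simp))
        have hb := hm b (hL b (by simp))
        refine ⟨a ++ s, t ++ L.flatten, by simp [← hst], ?_, ?_⟩
        · rw [List.length_append]; omega
        · rw [← hst] at hb
          simp only [List.length_append] at hb ⊢
          omega

/-- The shift on one-sided sequences. -/
def shift (y : ℕ → ULift.{u} Bool) : ℕ → ULift.{u} Bool := fun n => y (n + 1)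

lemma continuous_shift : Continuous shift.{u} :=
  continuous_pi fun n => continuous_apply (n + 1)

lemma shift_iterate (n i : ℕ) (y : ℕ → ULift.{u} Bool) : shift^[n] y i = y (i + n) := by
  induction n generalizing y with
  | zero => rfl
  | succ n ih => rw [Function.iterate_succ_apply, ih]; rfl

lemma exists_adapted_sequence [Nonempty X]
    (hrun : ∀ L : ℕ, ∃ g : ℕ, ∀ x : X, ∃ s ≤ g, ∀ j < L, T^[s + j] x ∉ U) :
    ∃ W : ℕ → Language (ULift.{u} Bool), (∀ k, IsAdapted T U (W k)) ∧ [mark] ∈ W 0 ∧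
      (∀ k, W (k + 1) ≤ (W k)∗) ∧
      ∀ k, ∀ w' ∈ W (k + 1), ∀ w ∈ W k, w <:+: w' ∧ w.length < w'.length := by
  -- The unmarked letter fits everywhere; `[mark]` is included so that every later word contains a
  -- mark.
  have h0 : IsAdapted T U ({[mark], [⟨false⟩]} : Set (List (ULift.{u} Bool))) := by
    refine ⟨⟨[mark], mem_insert _ _⟩, (List.finite_length_le _ 1).subset ?_, ?_,
      fun x => ⟨[⟨false⟩], mem_insert_of_mem _ rfl, fun i hi => ?_⟩⟩
    · rintro w (rfl | rfl) <;> simp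
    · rintro w (rfl | rfl) <;> simp
    · cases i <;> simp [mark] at hi
  choose F hF using fun W : {W : Language (ULift.{u} Bool) // IsAdapted T U W} =>
    W.2.exists_refinement hrun
  let G : ℕ → {W : Language (ULift.{u} Bool) // IsAdapted T U W} :=
    fun k => Nat.rec ⟨_, h0⟩ (fun _ W => ⟨F W, (hF W).1⟩) k
  exact ⟨fun k => (G k).1, fun k => (G k).2, mem_insert _ _, fun k => (hF (G k)).2.1,
    fun k => (hF (G k)).2.2⟩

/-- If long stays outside `U` occur with bounded gaps, then above each point `x` there is a minimal
point of the shift, not identically zero, whose marks avoid the visits of `x` to `U`. -/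
lemma exists_isMinimalPoint_shift
    (hrun : ∀ L : ℕ, ∃ g : ℕ, ∀ x : X, ∃ s ≤ g, ∀ j < L, T^[s + j] x ∉ U) (x : X) :
    ∃ y : ℕ → ULift.{u} Bool, IsMinimalPoint shift y ∧ (∃ k, y k = mark) ∧
      ∀ i, y i = mark → T^[i] x ∉ U := by
  have : Nonempty X := ⟨x⟩
  obtain ⟨W, hW, hW0, hsucc, hinf⟩ := exists_adapted_sequence.{u} hrun
  have hlen : ∀ k, ∀ w ∈ W k, k ≤ w.length := by
    intro k
    induction k with
    | zero => exact fun w _ => Nat.zero_le _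
    | succ k ih =>
      intro w' hw'
      obtain ⟨w, hw⟩ := (hW k).nonempty
      exact (ih w hw).trans_lt (hinf k w' hw' w hw).2
  have hnest : ∀ j k, j ≤ k → W k ≤ (W j)∗ := by
    intro j k hjk
    induction k, hjk using Nat.le_induction with
    | base => exact le_kstar
    | succ k _ ih => exact (hsucc k).trans ((kstar_mono ih).trans_eq (kstar_idem _))
  choose w hwW hw using fun k => (hW k).exists_avoids x
  -- The padding value is immaterial, since the lengths of the words `w k` tend to infinity.
  obtain ⟨y, φ, hφ, hy⟩ := CompactSpace.tendsto_subseq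
    (fun k i => ((w k)[i]?).getD ⟨false⟩ : ℕ → ℕ → ULift.{u} Bool)
  -- arbitrarily long prefixes of `y` are prefixes of the chosen words
  have hpre : ∀ n j : ℕ, ∃ k ≥ j, n ≤ (w k).length ∧ ∀ i < n, (w k)[i]? = some (y i) := by
    intro n j
    have h1 : ∀ᶠ k in atTop, ∀ i ∈ Finset.range n, ((w (φ k))[i]?).getD ⟨false⟩ = y i := by
      rw [Finset.eventually_all]
      intro i _
      have := (tendsto_pi_nhds.1 hy) i
      rw [nhds_discrete, tendsto_pure] at this
      exact this
    obtain ⟨k, hk, hkj⟩ := (h1.and (eventually_ge_atTop (max n j))).exists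
    have hkφ : max n j ≤ φ k := hkj.trans (hφ.id_le k)
    have hn : n ≤ (w (φ k)).length :=
      ((le_max_left _ _).trans hkφ).trans (hlen _ _ (hwW _))
    refine ⟨φ k, (le_max_right _ _).trans hkφ, hn, fun i hi => ?_⟩
    have := hk i (Finset.mem_range.2 hi)
    rw [List.getElem?_eq_getElem (hi.trans_le hn), Option.getD_some] at this
    rw [List.getElem?_eq_getElem (hi.trans_le hn), this]
  -- Long prefixes of `y` are prefixes of concatenations from `W (j + 1)`, each factor of which
  -- contains `v`; the gap depends only on `j`.
  have hocc : ∀ j, ∀ v ∈ W j, ∃ N, ∀ i, ∃ n, i ≤ n ∧ n ≤ i + N ∧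
      ∀ l < v.length, v[l]? = some (y (n + l)) := by
    intro j v hv
    obtain ⟨m, hm⟩ := exists_length_le (hW (j + 1)).finite
    have hm0 : 0 < m := by
      obtain ⟨a, ha⟩ := (hW (j + 1)).nonempty
      exact (List.length_pos_of_ne_nil ((hW (j + 1)).ne_nil a ha)).trans_le (hm a ha)
    refine ⟨2 * m, fun i => ?_⟩
    obtain ⟨k, hkj, hk, hky⟩ := hpre (i + 2 * m + v.length) (j + 1)
    obtain ⟨s, t, hst, h1, h2⟩ := exists_occurrence hm (fun a ha => (hinf j a ha v hv).1)
      (hnest (j + 1) k hkj (hwW k)) i (by omega) hm0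
    refine ⟨s.length, h1, h2, fun l hl => ?_⟩
    rw [← hky _ (by omega), hst, List.append_assoc, List.getElem?_append_right (by omega),
      Nat.add_sub_cancel_left, List.getElem?_append_left hl]
  refine ⟨y, ?_, ?_, ?_⟩
  · refine isMinimalPoint_of_isSyndetic continuous_shift fun O hO hyO => ?_
    obtain ⟨_, ⟨z, n, rfl⟩, hyz, hzO⟩ :=
      (PiNat.isTopologicalBasis_cylinders fun _ : ℕ => ULift.{u} Bool).exists_subset_of_mem_open
        hyO hO
    rw [← PiNat.mem_cylinder_iff_eq.1 hyz] at hzO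
    -- the prefix of length `n` of `y` is a prefix of a word of `W n`
    obtain ⟨v, hv, hvy⟩ : ∃ v ∈ W n, ∀ i < n, v[i]? = some (y i) := by
      obtain ⟨k, hkn, hk, hky⟩ := hpre (n + 1) n
      obtain ⟨L, hL, hLW⟩ := Language.mem_kstar.1 (hnest n k hkn (hwW k))
      cases L with
      | nil => simp [hL] at hk
      | cons v L =>
        have hvW := hLW v (by simp)
        refine ⟨v, hvW, fun i hi => ?_⟩
        rw [← hky i (by omega), hL, List.flatten_cons,
          List.getElem?_append_left (hi.trans_le (hlen n v hvW))]
    obtain ⟨N, hN⟩ := hocc n v hv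
    refine ⟨N, fun i => ?_⟩
    obtain ⟨a, hia, hai, ha⟩ := hN i
    refine ⟨a, ⟨hia, hai⟩, hzO ?_⟩
    rw [PiNat.mem_cylinder_iff]
    intro l hl
    have := ha l (hl.trans_le (hlen n v hv))
    rw [hvy l hl, Option.some_inj] at this
    rw [shift_iterate, add_comm, this]
  · obtain ⟨N, hN⟩ := hocc 0 [mark] hW0
    obtain ⟨a, -, -, ha⟩ := hN 0
    exact ⟨a, by simpa using (ha 0 (by simp)).symm⟩
  · intro i hi
    obtain ⟨k, -, -, hk⟩ := hpre (i + 1) 0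
    exact hw k i (by rw [hk i (by omega), hi])

end Words

/-! ### Furstenberg's lemma and simultaneous hitting times. -/

section WeakMixing

variable {X : Type*} [TopologicalSpace X] {T : X → X}

lemma isWeaklyMixing_of_exists (h : ∀ U₁ U₂ V₁ V₂ : Set X, IsOpen U₁ → U₁.Nonempty → IsOpen U₂ →
    U₂.Nonempty → IsOpen V₁ → V₁.Nonempty → IsOpen V₂ → V₂.Nonempty → ∀ m : ℕ,
    ∃ n ≥ m, n ∈ setHitTimes T U₁ V₁ ∧ n ∈ setHitTimes T U₂ V₂) : IsWeaklyMixing T := by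
  intro U V hU ⟨u, hu⟩ hV ⟨v, hv⟩
  obtain ⟨U₁, U₂, hU₁, hU₂, hu₁, hu₂, hUU⟩ := isOpen_prod_iff.1 hU u.1 u.2 hu
  obtain ⟨V₁, V₂, hV₁, hV₂, hv₁, hv₂, hVV⟩ := isOpen_prod_iff.1 hV v.1 v.2 hv
  refine Set.infinite_of_forall_exists_gt fun m => ?_
  obtain ⟨n, hn, ⟨a, haU, haV⟩, ⟨b, hbU, hbV⟩⟩ := h U₁ U₂ V₁ V₂ hU₁ ⟨_, hu₁⟩ hU₂ ⟨_, hu₂⟩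
    hV₁ ⟨_, hv₁⟩ hV₂ ⟨_, hv₂⟩ (m + 1)
  refine ⟨n, ⟨(a, b), hUU ⟨haU, hbU⟩, ?_⟩, hn⟩
  rw [mem_preimage, iterate_prodMap]
  exact hVV ⟨haV, hbV⟩

/-- Furstenberg's intersection lemma. -/
lemma IsWeaklyMixing.exists_setHitTimes_subset (h : IsWeaklyMixing T) (hT : Continuous T)
    {U₁ U₂ V₁ V₂ : Set X} (hU₁ : IsOpen U₁) (hU₁' : U₁.Nonempty) (hU₂ : IsOpen U₂)
    (hU₂' : U₂.Nonempty) (hV₁ : IsOpen V₁) (hV₁' : V₁.Nonempty) (hV₂ : IsOpen V₂)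
    (hV₂' : V₂.Nonempty) :
    ∃ U V : Set X, IsOpen U ∧ U.Nonempty ∧ IsOpen V ∧ V.Nonempty ∧
      setHitTimes T U V ⊆ setHitTimes T U₁ V₁ ∩ setHitTimes T U₂ V₂ := by
  -- One time `k` leads both from `U₁` to `U₂` and from `V₁` to `V₂`; then `T^[k]` carries a hit of
  -- the first pair to a hit of the second.
  obtain ⟨k, p, hp, hpk⟩ := (h (U₁ ×ˢ V₁) (U₂ ×ˢ V₂) (hU₁.prod hV₁) (hU₁'.prod hV₁')
    (hU₂.prod hV₂) (hU₂'.prod hV₂')).nonempty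
  rw [mem_preimage, iterate_prodMap] at hpk
  refine ⟨U₁ ∩ T^[k] ⁻¹' U₂, V₁ ∩ T^[k] ⁻¹' V₂, hU₁.inter (hU₂.preimage (hT.iterate k)),
    ⟨p.1, hp.1, hpk.1⟩, hV₁.inter (hV₂.preimage (hT.iterate k)), ⟨p.2, hp.2, hpk.2⟩, ?_⟩
  rintro n ⟨x, ⟨hx₁, hx₂⟩, hn₁, hn₂⟩
  refine ⟨⟨x, hx₁, hn₁⟩, ⟨T^[k] x, hx₂, ?_⟩⟩
  rw [mem_preimage, ← Function.iterate_add_apply, add_comm, Function.iterate_add_apply]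
  exact hn₂

lemma IsWeaklyMixing.isTransitive (h : IsWeaklyMixing T) : IsTransitive T := by
  intro U V hU hU' hV hV'
  refine (h (U ×ˢ U) (V ×ˢ V) (hU.prod hU) (hU'.prod hU') (hV.prod hV) (hV'.prod hV')).mono ?_
  rintro n ⟨p, hp, hn⟩
  rw [mem_preimage, iterate_prodMap] at hn
  exact ⟨p.1, hp.1, hn.1⟩

lemma IsWeaklyMixing.exists_setHitTimes_subset_biInter (h : IsWeaklyMixing T) (hT : Continuous T)
    {ι : Type*} (s : Finset ι) (W : ι → Set X) (hW : ∀ i ∈ s, IsOpen (W i))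
    (hW' : ∀ i ∈ s, (W i).Nonempty) {O : Set X} (hO : IsOpen O) (hO' : O.Nonempty) :
    ∃ U V : Set X, IsOpen U ∧ U.Nonempty ∧ IsOpen V ∧ V.Nonempty ∧
      ∀ i ∈ s, setHitTimes T U V ⊆ setHitTimes T O (W i) := by
  classical
  induction s using Finset.induction_on with
  | empty => exact ⟨O, O, hO, hO', hO, hO', by simp⟩
  | insert a s ha ih =>
    obtain ⟨U, V, hU, hU', hV, hV', hs⟩ := ih (fun i hi => hW i (Finset.mem_insert_of_mem hi))
      (fun i hi => hW' i (Finset.mem_insert_of_mem hi))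
    obtain ⟨U₀, V₀, hU₀, hU₀', hV₀, hV₀', h₀⟩ := h.exists_setHitTimes_subset hT hU hU' hO hO'
      hV hV' (hW a (Finset.mem_insert_self a s)) (hW' a (Finset.mem_insert_self a s))
    refine ⟨U₀, V₀, hU₀, hU₀', hV₀, hV₀', fun i hi => ?_⟩
    rcases Finset.mem_insert.1 hi with rfl | hi
    · exact h₀.trans inter_subset_right
    · exact (h₀.trans inter_subset_left).trans (hs i hi)

end WeakMixing

/-! ### Points proximal to a countable set along thick sets of times. -/

section Proximal

variable {X : Type*} [MetricSpace X] [CompactSpace X] {T : X → X}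

/-- In a weakly mixing system, `T ^ m x` comes close to a given point `d` for a long time, for a
dense set of `x`. -/
lemma IsWeaklyMixing.dense_proximal (h : IsWeaklyMixing T) (hT : Continuous T) (d : X) (m L : ℕ)
    {ε : ℝ} (hε : 0 < ε) :
    Dense (⋃ n : ℕ, ⋂ j ∈ Finset.range L, {x | dist (T^[n + j + m] x) (T^[n + j] d) < ε}) := by
  rw [dense_iff_inter_open]
  intro U hU hU'
  have huc : ∀ j : ℕ, ∃ δ > 0, ∀ a b : X, dist a b < δ → dist (T^[j] a) (T^[j] b) < ε := fun j => by
    obtain ⟨δ, hδ, H⟩ := Metric.uniformContinuous_iff.1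
      (CompactSpace.uniformContinuous_of_continuous (hT.iterate j)) ε hε
    exact ⟨δ, hδ, fun a b hab => H hab⟩
  choose δ hδ hδε using huc
  obtain ⟨η, hη, hηδ⟩ : ∃ η > 0, ∀ j ∈ Finset.range L, η ≤ δ j := by
    rcases (Finset.range L).eq_empty_or_nonempty with h0 | h0
    · exact ⟨1, one_pos, by simp [h0]⟩
    · exact ⟨(Finset.range L).inf' h0 δ, (Finset.lt_inf'_iff h0).2 fun j _ => hδ j,
        fun j hj => Finset.inf'_le _ hj⟩
  -- The target `T^[n + 1] d` depends on the hitting time `m + n + 1` itself, so that time is chosen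
  -- to hit every ball of a finite cover.
  obtain ⟨t, -, ht, hcov⟩ := finite_cover_balls_of_compact (isCompact_univ (X := X)) (half_pos hη)
  obtain ⟨U₀, V₀, hU₀, hU₀', hV₀, hV₀', hs⟩ := h.exists_setHitTimes_subset_biInter hT
    ht.toFinset (fun c => Metric.ball c (η / 2)) (fun _ _ => Metric.isOpen_ball)
    (fun c _ => ⟨c, Metric.mem_ball_self (half_pos hη)⟩) hU hU'
  obtain ⟨k, hk, hmk⟩ := (h.isTransitive U₀ V₀ hU₀ hU₀' hV₀ hV₀').exists_gt m
  obtain ⟨n, rfl⟩ := Nat.exists_eq_add_of_lt hmk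
  obtain ⟨c, hc, hdc⟩ := mem_iUnion₂.1 (hcov (mem_univ (T^[n + 1] d)))
  obtain ⟨x, hxU, hx⟩ := hs c (ht.mem_toFinset.2 hc) hk
  refine ⟨x, hxU, mem_iUnion.2 ⟨n + 1, mem_iInter₂.2 fun j hj => ?_⟩⟩
  have hclose : dist (T^[m + n + 1] x) (T^[n + 1] d) < η := by
    have h1 := Metric.mem_ball.1 hx
    have h2 := Metric.mem_ball.1 hdc
    linarith [dist_triangle_right (T^[m + n + 1] x) (T^[n + 1] d) c]
  have := hδε j _ _ (hclose.trans_le (hηδ j hj))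
  rw [← Function.iterate_add_apply, ← Function.iterate_add_apply] at this
  rw [mem_ofPred_eq, show n + 1 + j + m = j + (m + n + 1) by omega, add_comm (n + 1) j]
  exact this

/-- For countable `D` in a weakly mixing system, some point has all its iterates proximal to every
point of `D`, at thick sets of times. -/
lemma IsWeaklyMixing.exists_proximal [Nonempty X] (h : IsWeaklyMixing T) (hT : Continuous T)
    {D : Set X} (hD : D.Countable) :
    ∃ x : X, ∀ d ∈ D, ∀ m L : ℕ, ∀ ε > 0,
      ∃ n : ℕ, ∀ j < L, dist (T^[n + j + m] x) (T^[n + j] d) < ε := by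
  have := hD.to_subtype
  have hd : Dense (⋂ p : D × ℕ × ℕ × ℕ, ⋃ n : ℕ, ⋂ j ∈ Finset.range p.2.2.1,
      {x | dist (T^[n + j + p.2.1] x) (T^[n + j] (p.1 : X)) < 1 / ((p.2.2.2 : ℝ) + 1)}) := by
    refine dense_iInter_of_isOpen (fun p => ?_) (fun p => ?_)
    · refine isOpen_iUnion fun n => isOpen_biInter_finset fun j _ => ?_
      exact isOpen_lt ((hT.iterate _).dist continuous_const) continuous_const
    · exact h.dense_proximal hT _ _ _ Nat.one_div_pos_of_nat
  obtain ⟨x, hx⟩ := hd.nonempty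
  refine ⟨x, fun d hdD m L ε hε => ?_⟩
  obtain ⟨k, hk⟩ := exists_nat_one_div_lt hε
  obtain ⟨n, hn⟩ := mem_iUnion.1 (mem_iInter.1 hx (⟨d, hdD⟩, m, L, k))
  exact ⟨n, fun j hj => (mem_iInter₂.1 hn j (Finset.mem_range.2 hj)).trans hk⟩

end Proximal

/-! ### The implications of the theorem. -/

variable {X : Type u} [MetricSpace X] [CompactSpace X] {T : X → X}

/-- Weak mixing and syndetic transfer for a countable set imply disjointness. -/
lemma disjointFromAllMinimal_of_hasSyndeticTransfer (hT : Continuous T) (h : IsWeaklyMixing T)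
    {D : Set X} (hD : D.Countable) (htr : HasSyndeticTransfer T D) :
    DisjointFromAllMinimal T := by
  intro Y _ _ S hS J hJ
  have : Nonempty X := hJ.nonempty.elim fun p _ => ⟨p.1⟩
  obtain ⟨x, hx⟩ := h.exists_proximal hT hD
  obtain ⟨⟨x', y⟩, hxy, rfl⟩ : x ∈ Prod.fst '' J := hJ.fst_image ▸ mem_univ x
  rw [eq_univ_iff_forall]
  rintro ⟨a, b⟩
  rw [← hJ.isClosed.closure_eq]
  refine mem_closure_iff.2 fun O hO hab => ?_
  obtain ⟨U, V, hU, hV, haU, hbV, hUV⟩ := isOpen_prod_iff.1 hO a b hab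
  obtain ⟨ε, hε, hεU⟩ := Metric.isOpen_iff.1 hU a haU
  obtain ⟨_, hmV, m, rfl⟩ := (hS.dense_orbit y).inter_open_nonempty V hV ⟨b, hbV⟩
  obtain ⟨d, ⟨hdD, -⟩, N, hN⟩ := htr Y S hS (S^[m] y) V hV hmV (Metric.ball a (ε / 2))
    Metric.isOpen_ball ⟨a, Metric.mem_ball_self (half_pos hε)⟩
  -- A window of `N + 1` consecutive times meets a set whose gaps are bounded by `N`.
  obtain ⟨n, hn⟩ := hx d hdD m (N + 1) (ε / 2) (half_pos hε)
  obtain ⟨k, ⟨hnk, hkn⟩, hk⟩ := hN n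
  obtain ⟨j, rfl⟩ := Nat.exists_eq_add_of_le hnk
  have hk' : T^[n + j] d ∈ Metric.ball a (ε / 2) ∧ S^[n + j] (S^[m] y) ∈ V := by
    have hk2 : (Prod.map T S)^[n + j] (d, S^[m] y) ∈ Metric.ball a (ε / 2) ×ˢ V := hk
    rwa [iterate_prodMap] at hk2
  refine ⟨(Prod.map T S)^[n + j + m] (x', y), hUV ?_, hJ.invariant.iterate _ hxy⟩
  rw [iterate_prodMap]
  refine ⟨hεU (Metric.mem_ball.2 ?_), ?_⟩
  · have h1 := Metric.mem_ball.1 hk'.1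
    have h2 := hn j (by omega)
    linarith [dist_triangle (T^[n + j + m] x') (T^[n + j] d) a]
  · have := hk'.2
    rwa [← Function.iterate_add_apply] at this

/-- If the open set `U` contains no minimal point, every point makes long stays outside a
given closed subset of `U`, with bounded gaps. -/
lemma exists_long_stays_outside (hT : Continuous T) {U C : Set X} (hC : IsClosed C) (hCU : C ⊆ U)
    (hU : ∀ x ∈ U, ¬ IsMinimalPoint T x) (L : ℕ) :
    ∃ g : ℕ, ∀ x : X, ∃ s ≤ g, ∀ j < L, T^[s + j] x ∉ C := by
  have hO : IsOpen (⋂ j ∈ Finset.range L, T^[j] ⁻¹' Cᶜ) :=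
    isOpen_biInter_finset fun j _ => hC.isOpen_compl.preimage (hT.iterate j)
  obtain ⟨t, ht⟩ := (isCompact_univ (X := X)).elim_finite_subcover
    (fun s : ℕ => T^[s] ⁻¹' ⋂ j ∈ Finset.range L, T^[j] ⁻¹' Cᶜ)
    (fun s => hO.preimage (hT.iterate s)) (by
      intro x _
      -- Every iterate of a minimal point is minimal, so the orbit of `z` never enters `U`; the
      -- given orbit follows it for `L` steps.
      obtain ⟨z, hzx, hz⟩ := exists_isMinimalPoint_mem_closure_orbit hT x
      have hzO : z ∈ ⋂ j ∈ Finset.range L, T^[j] ⁻¹' Cᶜ := by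
        refine mem_iInter₂.2 fun j _ hj => hU _ (hCU hj) fun w hw => ?_
        have := iterate_mem_closure_orbit T z j
        rw [hz _ this] at hw ⊢
        exact hz w hw
      obtain ⟨_, hw, n, rfl⟩ := mem_closure_iff.1 hzx _ hO hzO
      exact mem_iUnion.2 ⟨n, hw⟩)
  refine ⟨t.sup id, fun x => ?_⟩
  obtain ⟨s, hs, hx⟩ := mem_iUnion₂.1 (ht (mem_univ x))
  refine ⟨s, Finset.le_sup (f := id) hs, fun j hj => ?_⟩
  have := mem_iInter₂.1 hx j (Finset.mem_range.2 hj)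
  rwa [mem_preimage, ← Function.iterate_add_apply, add_comm] at this

/-- A transitive system disjoint from all minimal systems has dense minimal points. -/
lemma DisjointFromAllMinimal.dense_isMinimalPoint (h : DisjointFromAllMinimal T)
    (hT : Continuous T) (ht : IsTransitive T) : Dense {x | IsMinimalPoint T x} := by
  rw [dense_iff_inter_open]
  intro U hU ⟨a, ha⟩
  by_contra hne
  obtain ⟨C, hC, hCc, hCU⟩ := exists_mem_nhds_isClosed_subset (hU.mem_nhds ha)
  have hCne : (interior C).Nonempty := ⟨a, mem_interior_iff_mem_nhds.2 hC⟩
  obtain ⟨x, -, hx⟩ := (ht.dense_isTransitivePoint hT).inter_open_nonempty U hU ⟨a, ha⟩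
  obtain ⟨y, hy, ⟨k, hk⟩, hyx⟩ := exists_isMinimalPoint_shift.{u}
    (exists_long_stays_outside hT hCc hCU fun x hxU hx => hne ⟨x, hxU, hx⟩) x
  obtain ⟨n, -, hnU, hnV⟩ := h.exists_iterate_mem_of_isMinimalPoint hT continuous_shift hx hy
    isOpen_interior hCne
    ((isOpen_discrete {mark}).preimage (continuous_apply (A := fun _ : ℕ => ULift.{u} Bool) 0))
    (k := k) (by rw [mem_preimage, shift_iterate, zero_add]; exact hk) 0
  rw [mem_preimage, shift_iterate, zero_add] at hnV
  exact hyx n hnV (interior_subset hnU)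

/-- A minimal `y` in `U₂` whose orbit meets `V₂`, paired with a transitive point of `U₁`, visits
both targets at a common late time. -/
lemma DisjointFromAllMinimal.isWeaklyMixing (h : DisjointFromAllMinimal T)
    (hT : Continuous T) (ht : IsTransitive T) : IsWeaklyMixing T := by
  refine isWeaklyMixing_of_exists fun U₁ U₂ V₁ V₂ hU₁ hU₁' hU₂ hU₂' hV₁ hV₁' hV₂ hV₂' m => ?_
  obtain ⟨k, hk⟩ := (ht U₂ V₂ hU₂ hU₂' hV₂ hV₂').nonempty
  obtain ⟨y, ⟨hyU, hyV⟩, hy⟩ := (h.dense_isMinimalPoint hT ht).inter_open_nonempty _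
    (hU₂.inter (hV₂.preimage (hT.iterate k))) hk
  obtain ⟨x, hxU, hx⟩ := (ht.dense_isTransitivePoint hT).inter_open_nonempty U₁ hU₁ hU₁'
  obtain ⟨n, hn, hn₁, hn₂⟩ :=
    h.exists_iterate_mem_of_isMinimalPoint hT hT hx hy hV₁ hV₁' hV₂ hyV m
  exact ⟨n, hn, ⟨x, hxU, hn₁⟩, ⟨y, hyU, hn₂⟩⟩

/-- If the system is transitive and disjoint from all minimal systems, syndetic transfer holds for
every dense set of minimal points. -/
lemma DisjointFromAllMinimal.hasSyndeticTransfer (h : DisjointFromAllMinimal T)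
    (hT : Continuous T) (ht : IsTransitive T) {D : Set X} (hD : Dense D)
    (hDm : ∀ x ∈ D, IsMinimalPoint T x) : HasSyndeticTransfer T D := by
  intro Y _ _ S hS y V hV hyV U hU hU'
  obtain ⟨x₀, hx₀U, hx₀⟩ := (ht.dense_isTransitivePoint hT).inter_open_nonempty U hU hU'
  obtain ⟨F, hF⟩ := (isCompact_univ (X := Y)).elim_finite_subcover
    (fun n : {n : ℕ // T^[n] x₀ ∈ U} => S^[n] ⁻¹' V)
    (fun n => hV.preimage (hS.isTDS.continuous.iterate n)) (by
      intro z _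
      obtain ⟨n, -, hnU, hnV⟩ := h.exists_iterate_mem hT hS hx₀ z hU hU' hV ⟨y, hyV⟩ 0
      exact mem_iUnion.2 ⟨⟨n, hnU⟩, hnV⟩)
  have hWo : IsOpen (U ∩ ⋂ n ∈ F, T^[n] ⁻¹' U) :=
    hU.inter (isOpen_biInter_finset fun n _ => hU.preimage (hT.iterate n))
  obtain ⟨x, hxW, hxD⟩ := hD.inter_open_nonempty _ hWo ⟨x₀, hx₀U, mem_iInter₂.2 fun n _ => n.2⟩
  obtain ⟨N, hN⟩ := (hDm x hxD).isSyndetic_hitTimes hT hWo hxW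
  -- At a return time `k` of `x`, some `n` in `F` sends `S^[k] y` into `V` while `T^[n + k] x` is in
  -- `U`; the delay adds at most the maximum of `F`.
  refine ⟨x, ⟨hxD, hxW.1⟩, N + F.sup Subtype.val, fun i => ?_⟩
  obtain ⟨k, ⟨hik, hki⟩, -, hk⟩ := hN i
  obtain ⟨n, hnF, hn⟩ := mem_iUnion₂.1 (hF (mem_univ (S^[k] y)))
  have hle : (n : ℕ) ≤ F.sup Subtype.val := Finset.le_sup (f := Subtype.val) hnF
  refine ⟨n + k, ⟨by omega, by omega⟩, ?_⟩
  have hk' := mem_iInter₂.1 hk n hnF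
  rw [mem_preimage, ← Function.iterate_add_apply] at hk' hn
  change (Prod.map T S)^[n + k] (x, y) ∈ U ×ˢ V
  rw [iterate_prodMap]
  exact ⟨hk', hn⟩

end TopDyn

theorem theorem3p1 {X : Type u} [MetricSpace X] [CompactSpace X] (T : X → X)
    (hT : TopDyn.IsTDS T) (htrans : TopDyn.IsTransitive T) :
    List.TFAE
      [TopDyn.DisjointFromAllMinimal T,
       TopDyn.IsWeaklyMixing T ∧
         ∃ D : Set X, D.Countable ∧ Dense D ∧ TopDyn.HasSyndeticTransfer T D,
       TopDyn.IsWeaklyMixing T ∧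
         ∃ D : Set X, D.Countable ∧ Dense D ∧ (∀ x ∈ D, TopDyn.IsMinimalPoint T x) ∧
           TopDyn.HasSyndeticTransfer T D] := by
  tfae_have 3 → 2 := fun ⟨h, D, hDc, hDd, _, hD⟩ => ⟨h, D, hDc, hDd, hD⟩
  tfae_have 2 → 1 := fun ⟨h, _, hDc, _, hD⟩ =>
    TopDyn.disjointFromAllMinimal_of_hasSyndeticTransfer hT.continuous h hDc hD
  tfae_have 1 → 3 := by
    intro h
    obtain ⟨D, hDm, hDc, hD⟩ :=
      (h.dense_isMinimalPoint hT.continuous htrans).exists_countable_dense_subset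
    exact ⟨h.isWeaklyMixing hT.continuous htrans, D, hDc, hD, hDm,
      h.hasSyndeticTransfer hT.continuous htrans hD hDm⟩
  tfae_finish
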